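/- An \emph{ordinal Turing machine} (OTM) has finitely many two-way tapes whose cells are indexed by the ordinals, each with its own head, and finitely many states, numbered by natural numbers. One tape is a (read-only) input tape; the others, at least one, are scratch tapes with cells in $\{0,1\}$. At time $0$ the machine is in state $0$, all heads are on cell $0$ and all scratch cells contain $0$. At successor times it acts like an ordinary multitape Turing machine, according to a finite program; a head that moves left from cell $0$ or from a cell whose index is a limit ordinal goes to cell $0$. At a limit time, the state and the content of each cell are the inferior limits of their earlier values, and each head is at the inferior limit of its positions at those earlier times at which the machine was in the limit state. The machine stops when it reaches a halting state; its output is then the content of cell $0$ of the first scratch tape. Let $\{0,1\}^{**}$ be the class of all functions $w:\alpha\to\{0,1\}$ with $\alpha$ an ordinal, and let $|w|=\alpha$ be the length of $w$. The input $w$ is written on the first $|w|$ cells of the input tape, and all further cells of that tape are blank. For a function $f$ from ordinals to ordinals, a class $\mathcal{L}\subseteq\{0,1\}^{**}$ is \emph{decidable in running time $f(\alpha)$} if there is an OTM-program (with any finite number of scratch tapes) that, on every input $w\in\{0,1\}^{**}$, stops with output $1$ if $w\in\mathcal{L}$ and with output $0$ if $w\notin\mathcal{L}$, and that stops after at most $f(|w|)$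 many steps on every nonempty $w$. \textbf{Theorem.} There is a decision problem $\mathcal{L}\subseteq\{0,1\}^{**}$ that is decidable in running time $\alpha\cdot 4$, but not in running time $\alpha\cdot 2$ (ordinal multiplication, where $\alpha$ denotes the length of the input). -/

import Mathlib

universe u

namespace OTM

open Set Order

/-- `{0,1}^{**}`: a word is a function from the ordinals below some ordinal to `{0,1}`. -/
def Word : Type (u + 1) := Σ α : Ordinal.{u}, (Iio α → Bool)

/-- The length `|w|` of a word. -/
def Word.length (w : Word.{u}) : Ordinal.{u} := w.1

/-- The content of the input tape at position `ξ`: the symbol of `w` there, and `none` (blank)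
from position `|w|` on. -/
noncomputable def Word.read (w : Word.{u}) (ξ : Ordinal.{u}) : Option Bool :=
  open Classical in if h : ξ < w.1 then some (w.2 ⟨ξ, h⟩) else none

/-- Head movements. -/
inductive Move : Type
  | left
  | stay
  | right

/-- The cell reached by a head at `ξ`.  A head that moves to the left from cell `0` or from a cell
whose index is a limit ordinal arrives at cell `0`. -/
noncomputable def Move.apply (m : Move) (ξ : Ordinal.{u}) : Ordinal.{u} :=
  match m with
  | .left => Ordinal.limitRecOn ξ 0 (fun η _ => η) (fun _ _ _ => 0)
  | .stay => ξ
  | .right => ξ + 1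

/-- What a program does in one step: the new state, the movement of the head on the input tape,
and, for each scratch tape, the symbol to write and the movement of its head. -/
structure Action (states tapes : ℕ) : Type where
  state : Fin (states + 1)
  moveInput : Move
  write : Fin (tapes + 1) → Bool
  move : Fin (tapes + 1) → Move

/-- A program of a multitape ordinal Turing machine.  It has `states` many working states
`0, …, states - 1` and one halting state, `states`; the machine starts in state `0`.  It has a
read-only input tape and `tapes + 1` scratch tapes with cells in `{0,1}`; every tape has
its own head.  The transition depends on the state, the symbol under the head of the input tape
(or blank) and the symbols under the heads of the scratch tapes. -/
structure Program : Type where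
  states : ℕ
  tapes : ℕ
  next : Fin states → Option Bool → (Fin (tapes + 1) → Bool) → Action states tapes

/-- A configuration (snapshot) of a machine with program `P`. -/
structure Config (P : Program) : Type (u + 1) where
  state : Fin (P.states + 1)
  headInput : Ordinal.{u}
  head : Fin (P.tapes + 1) → Ordinal.{u}
  tape : Fin (P.tapes + 1) → Ordinal.{u} → Bool

/-- The machine has stopped. -/
def Config.Halted {P : Program} (c : Config.{u} P) : Prop := c.state = Fin.last P.states

/-- The output: the content of the first cell of the first scratch tape. -/
def Config.output {P : Program} (c : Config.{u} P) : Bool := c.tape 0 0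

/-- The initial configuration: state `0`, all heads on cell `0`, all scratch tapes filled with
`0`. -/
def Config.init (P : Program) : Config.{u} P where
  state := 0
  headInput := 0
  head _ := 0
  tape _ _ := false

/-- One step of the computation on input `w`; nothing changes once the machine has stopped. -/
noncomputable def Config.step {P : Program} (w : Word.{u}) (c : Config.{u} P) : Config.{u} P :=
  open Classical in
  if h : c.state = Fin.last P.states then c
  else
    let a := P.next (c.state.castPred h) (w.read c.headInput) (fun i => c.tape i (c.head i))
    { state := a.state
      headInput := a.moveInput.apply c.headInput
      head := fun i => (a.move i).apply (c.head i)
      tape := fun i => Function.update (c.tape i) (c.head i) (a.write i) }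

/-- `liminf f t`, for `t` tending to `l` from below through the `t < l` with `p t`. -/
noncomputable def liminfBelow {X : Type*} [SupSet X] [InfSet X] (l : Ordinal.{u})
    (p : Iio l → Prop) (f : Iio l → X) : X :=
  ⨆ r : Iio l, ⨅ t : {t : Iio l // r ≤ t ∧ p t}, f t.1

/-- The state at a limit time `l`: the inferior limit of the earlier states. -/
noncomputable def limitState {P : Program} (l : Ordinal.{u}) (c : Iio l → Config.{u} P) :
    Fin (P.states + 1) :=
  liminfBelow l (fun _ => True) (fun t => (c t).state)

/-- The configuration at a limit time `l`: the state and each cell take the inferior limit of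
their earlier values, and each head goes to the inferior limit of its positions at those earlier
times at which the machine was in the limit state. -/
noncomputable def limitConfig {P : Program} (l : Ordinal.{u}) (c : Iio l → Config.{u} P) :
    Config.{u} P where
  state := limitState l c
  headInput := liminfBelow l (fun t => (c t).state = limitState l c) (fun t => (c t).headInput)
  head i := liminfBelow l (fun t => (c t).state = limitState l c) (fun t => (c t).head i)
  tape i ξ := liminfBelow l (fun _ => True) (fun t => (c t).tape i ξ)

/-- The configuration after `t` many steps on input `w`. -/
noncomputable def Program.run (P : Program) (w : Word.{u}) (t : Ordinal.{u}) : Config.{u} P :=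
  Ordinal.limitRecOn t (Config.init P) (fun _ c => c.step w)
    (fun l _ c => limitConfig l (fun s => c s.1 s.2))

theorem Program.run_zero (P : Program) (w : Word.{u}) : P.run w 0 = Config.init P :=
  Ordinal.limitRecOn_zero ..

theorem Program.run_succ (P : Program) (w : Word.{u}) (t : Ordinal.{u}) :
    P.run w (t + 1) = (P.run w t).step w :=
  Ordinal.limitRecOn_add_one ..

theorem Program.run_limit (P : Program) (w : Word.{u}) (l : Ordinal.{u}) (hl : IsSuccLimit l) :
    P.run w l = limitConfig l (fun s => P.run w s.1) :=
  Ordinal.limitRecOn_limit _ _ _ _ hl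

/-- On input `w`, the program `P` stops after exactly `t` many steps. -/
def Program.HaltsAt (P : Program) (w : Word.{u}) (t : Ordinal.{u}) : Prop :=
  (P.run w t).Halted ∧ ∀ s < t, ¬ (P.run w s).Halted

/-- `P` decides `L` in running time `f`: on every word `w`, `P` stops, with output `1` if `w ∈ L`
and with output `0` otherwise, and if `w` is nonempty, it stops after at most `f |w|` many steps.
(The bounds of interest are `0` at length `0`, and no machine with a working state stops
after `0` many steps.) -/
def Program.DecidesInTime (P : Program) (L : Set Word.{u}) (f : Ordinal.{u} → Ordinal.{u}) :
    Prop :=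
  ∀ w : Word.{u}, ∃ t : Ordinal.{u}, P.HaltsAt w t ∧ ((P.run w t).output = true ↔ w ∈ L) ∧
    (w.length ≠ 0 → t ≤ f w.length)

/-- `L` is decidable by an ordinal Turing machine in running time `f`. -/
def DecidableInTime (L : Set Word.{u}) (f : Ordinal.{u} → Ordinal.{u}) : Prop :=
  ∃ P : Program, P.DecidesInTime L f

end OTM

/-!
The separation takes place at words of length `ω`, and the reason for it is topological. A machine
that stops within `ω · 2` steps on such words stops at a time `ω + k`, since it cannot have just
stopped at a limit time. Its answer depends on a finite part of the configuration at time `ω`, and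
this part is given by inferior limits; so the words that it accepts form a `Δ⁰₄` set of sequences.
By time `ω · 2`, however, a machine can evaluate `Π⁰₄` conditions: each cell at time `ω` records
whether something has happened infinitely often, and the limit state at time `ω · 2` tells whether
there are infinitely many such cells. The language is the set of words accepted by the explicit
machine `Machine.program` that does this: it takes the input as a sequence of commands (bit to
write, direction to move) for its work head and then looks for infinitely many zeros on the work
tape (`Machine.halts_infinite`). It stops after at most `|w| + 1` steps on finite words and
`ω · 2 + 1` steps on all others, which is within `α · 4` (`Machine.decidesInTime`).

That no program `P` decides this language in time `α · 2` is shown by diagonalization, with a word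
that refers to itself. For every `K`, the finite set of snapshots of the first `K` cells that recur
infinitely often in the computation of `P` determines the configuration at time `ω` on these cells,
and for large `K` it determines the answer (`eventually_rejectsLike`,
`eventually_not_rejectsLike`). That a guess for this set is right is a statement of the form
`∀ m, ∃ n, R m n`, where `R m n` depends on the first `n` bits of the word, once the guess includes
the last time at which another snapshot occurs (`forall_exists_confirms_iff`). As `R m n` looks at
an initial segment only, a word can be defined by recursion whose commands write a zero into the
cell numbered by a guess whenever the guess is confirmed once more for the word itself and means
rejection (`exists_fixedPoint`). There is one right guess for every `K`, so the machine finds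
infinitely many zeros, and accepts this word, if and only if `P` rejects it.
-/

namespace OTM

open Set Order Ordinal Filter

/-! ### Limit configurations along `β, β + 1, β + 2, …` -/

theorem exists_le_add_natCast {β t : Ordinal.{u}} (ht : t < β + ω) : ∃ n : ℕ, t ≤ β + n := by
  obtain ⟨c, hc, h⟩ := (lt_add_iff omega0_pos.ne').1 ht
  obtain ⟨n, rfl⟩ := lt_omega0.1 hc
  exact ⟨n, h⟩

section Liminf

variable {X : Type*} [ConditionallyCompleteLinearOrderBot X] {β : Ordinal.{u}}
  {p : Ordinal.{u} → Prop} {f : Ordinal.{u} → X} {a b : X}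

theorem iInf_le_of_frequently (h : ∃ᶠ n : ℕ in atTop, p (β + n) ∧ f (β + n) ≤ a)
    (r : Iio (β + ω)) : ⨅ t : {t : Iio (β + ω) // r ≤ t ∧ p t.1}, f t.1.1 ≤ a := by
  obtain ⟨m, hm⟩ := exists_le_add_natCast r.2
  obtain ⟨n, hn, hp, hf⟩ := frequently_atTop.1 h m
  have hrn : r.1 ≤ β + n := hm.trans (by gcongr)
  exact (ciInf_le (OrderBot.bddBelow _) ⟨⟨β + n, by simp⟩, hrn, hp⟩).trans hf

theorem liminfBelow_add_omega0_le (h : ∃ᶠ n : ℕ in atTop, p (β + n) ∧ f (β + n) ≤ a) :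
    liminfBelow (β + ω) (fun t => p t.1) (fun t => f t.1) ≤ a := by
  have : Nonempty (Iio (β + ω)) := ⟨⟨β + (0 : ℕ), by simp⟩⟩
  exact ciSup_le (iInf_le_of_frequently h)

/-- The frequent upper bound `b` is there because suprema in `X` need to be bounded. -/
theorem le_liminfBelow_add_omega0 (h₁ : ∀ᶠ n : ℕ in atTop, p (β + n) → a ≤ f (β + n))
    (h₂ : ∃ᶠ n : ℕ in atTop, p (β + n) ∧ f (β + n) ≤ b) :
    a ≤ liminfBelow (β + ω) (fun t => p t.1) (fun t => f t.1) := by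
  obtain ⟨N, hN⟩ := eventually_atTop.1 h₁
  have hlt (n : ℕ) : β + n < β + ω := by simp
  refine le_trans ?_ (le_ciSup (ι := Iio (β + ω))
    ⟨b, by rintro _ ⟨r, rfl⟩; exact iInf_le_of_frequently h₂ r⟩ ⟨β + N, hlt N⟩)
  obtain ⟨m, hm, hp, -⟩ := frequently_atTop.1 h₂ N
  have : Nonempty {t : Iio (β + ω) // ⟨β + N, hlt N⟩ ≤ t ∧ p t.1} :=
    ⟨⟨⟨β + m, hlt m⟩, by show β + (N : Ordinal) ≤ β + m; gcongr, hp⟩⟩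
  refine le_ciInf fun t => ?_
  obtain ⟨⟨t, ht⟩, hrt, hpt⟩ := t
  replace hrt : β + (N : Ordinal) ≤ t := hrt
  obtain ⟨d, rfl⟩ := exists_add_of_le (le_self_add.trans hrt)
  obtain ⟨n, rfl⟩ := lt_omega0.1 ((add_lt_add_iff_left β).1 ht)
  exact hN n (by simpa using hrt) hpt

theorem liminfBelow_add_omega0_eq (h₁ : ∀ᶠ n : ℕ in atTop, p (β + n) → a ≤ f (β + n))
    (h₂ : ∃ᶠ n : ℕ in atTop, p (β + n) ∧ f (β + n) = a) :
    liminfBelow (β + ω) (fun t => p t.1) (fun t => f t.1) = a :=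
  have h₂' := h₂.mono fun _ h => h.imp_right le_of_eq
  (liminfBelow_add_omega0_le h₂').antisymm (le_liminfBelow_add_omega0 h₁ h₂')

end Liminf

/-- A sequence in a finite set eventually takes only values that it takes infinitely often. -/
theorem eventually_frequently_eq {S : Type*} [Finite S] (f : ℕ → S) :
    ∀ᶠ n in atTop, ∃ᶠ m in atTop, f m = f n := by
  have : ∀ᶠ n in atTop, ∀ s, (¬ ∃ᶠ m in atTop, f m = s) → f n ≠ s := by
    refine eventually_all.2 fun s => ?_
    by_cases h : ∃ᶠ m in atTop, f m = s
    · simp [h]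
    · exact (not_frequently.1 h).mono fun n hn _ => hn
  exact this.mono fun n hn => by_contra fun h => hn _ h rfl

/-- The position of a head: `none` stands for the head of the input tape. -/
def Config.pos {P : Program} (c : Config.{u} P) : Option (Fin (P.tapes + 1)) → Ordinal.{u}
  | none => c.headInput
  | some i => c.head i

section Limit

variable {P : Program} {w : Word.{u}} {β : Ordinal.{u}}

theorem Program.run_add_omega0 (P : Program) (w : Word.{u}) (β : Ordinal.{u}) :
    P.run w (β + ω) = limitConfig (β + ω) (fun s => P.run w s.1) :=
  P.run_limit w _ (isSuccLimit_add β isSuccLimit_omega0)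

theorem Program.run_add_succ (P : Program) (w : Word.{u}) (β : Ordinal.{u}) (n : ℕ) :
    P.run w (β + (n + 1 : ℕ)) = (P.run w (β + n)).step w := by
  rw [← P.run_succ, Nat.cast_succ, add_assoc]

theorem Program.run_natCast_succ (P : Program) (w : Word.{u}) (n : ℕ) :
    P.run w (n + 1 : ℕ) = (P.run w n).step w := by
  simpa using P.run_add_succ w 0 n

theorem state_add_omega0 {a : Fin (P.states + 1)}
    (h₁ : ∀ᶠ n : ℕ in atTop, a ≤ (P.run w (β + n)).state)
    (h₂ : ∃ᶠ n : ℕ in atTop, (P.run w (β + n)).state = a) :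
    (P.run w (β + ω)).state = a := by
  rw [P.run_add_omega0]
  exact liminfBelow_add_omega0_eq (p := fun _ => True) (f := fun t => (P.run w t).state)
    (h₁.mono fun _ h _ => h) (h₂.mono fun _ h => ⟨trivial, h⟩)

/-- The state at a limit time is the least one visited infinitely often. -/
theorem state_add_omega0_spec (P : Program) (w : Word.{u}) (β : Ordinal.{u}) :
    (∀ᶠ n : ℕ in atTop, (P.run w (β + ω)).state ≤ (P.run w (β + n)).state) ∧
      ∃ᶠ n : ℕ in atTop, (P.run w (β + n)).state = (P.run w (β + ω)).state := by
  have hev := eventually_frequently_eq fun n : ℕ => (P.run w (β + n)).state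
  obtain ⟨a, ha, hmin⟩ := exists_min_image
    {a | ∃ᶠ n : ℕ in atTop, (P.run w (β + n)).state = a} id (toFinite _)
    (hev.exists.imp' _ fun _ h => h)
  have hge : ∀ᶠ n : ℕ in atTop, a ≤ (P.run w (β + n)).state := hev.mono fun n hn => hmin _ hn
  rw [state_add_omega0 hge ha]
  exact ⟨hge, ha⟩

theorem tape_add_omega0_eq_true {i : Fin (P.tapes + 1)} {ξ : Ordinal.{u}}
    (h : ∀ᶠ n : ℕ in atTop, (P.run w (β + n)).tape i ξ = true) :
    (P.run w (β + ω)).tape i ξ = true := by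
  rw [P.run_add_omega0]
  exact liminfBelow_add_omega0_eq (p := fun _ => True) (f := fun t => (P.run w t).tape i ξ)
    (h.mono fun _ h _ => h.ge) (h.frequently.mono fun _ h => ⟨trivial, h⟩)

theorem tape_add_omega0_eq_false_iff {i : Fin (P.tapes + 1)} {ξ : Ordinal.{u}} :
    (P.run w (β + ω)).tape i ξ = false ↔
      ∃ᶠ n : ℕ in atTop, (P.run w (β + n)).tape i ξ = false := by
  refine ⟨fun h => ?_, fun h => ?_⟩
  · by_contra h'
    rw [tape_add_omega0_eq_true ((not_frequently.1 h').mono fun n hn => by simpa using hn)] at h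
    cases h
  · rw [P.run_add_omega0]
    exact liminfBelow_add_omega0_eq (p := fun _ => True) (f := fun t => (P.run w t).tape i ξ)
      (Eventually.of_forall fun _ _ => Bool.false_le _) (h.mono fun _ h => ⟨trivial, h⟩)

theorem pos_add_omega0 (P : Program) (w : Word.{u}) (β : Ordinal.{u})
    (i : Option (Fin (P.tapes + 1))) :
    (P.run w (β + ω)).pos i = liminfBelow (β + ω)
      (fun t => (P.run w t.1).state = (P.run w (β + ω)).state) (fun t => (P.run w t.1).pos i) := by
  rw [P.run_add_omega0]
  cases i <;> rfl

theorem pos_add_omega0_eq {i : Option (Fin (P.tapes + 1))} {a : Ordinal.{u}}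
    (h₁ : ∀ᶠ n : ℕ in atTop, (P.run w (β + n)).state = (P.run w (β + ω)).state →
      a ≤ (P.run w (β + n)).pos i)
    (h₂ : ∃ᶠ n : ℕ in atTop, (P.run w (β + n)).state = (P.run w (β + ω)).state ∧
      (P.run w (β + n)).pos i = a) :
    (P.run w (β + ω)).pos i = a := by
  rw [pos_add_omega0]
  exact liminfBelow_add_omega0_eq
    (p := fun t => (P.run w t).state = (P.run w (β + ω)).state)
    (f := fun t => (P.run w t).pos i) h₁ h₂

end Limit

/-! ### Single steps -/

theorem Config.step_of_state {P : Program} {w : Word.{u}} {c : Config.{u} P} {s : Fin P.states}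
    (h : c.state = s.castSucc) :
    c.step w =
      let a := P.next s (w.read c.headInput) (fun i => c.tape i (c.head i))
      { state := a.state
        headInput := a.moveInput.apply c.headInput
        head := fun i => (a.move i).apply (c.head i)
        tape := fun i => Function.update (c.tape i) (c.head i) (a.write i) } := by
  have h' : c.state ≠ Fin.last P.states := by rw [h]; exact s.castSucc_lt_last.ne
  have : c.state.castPred h' = s := by simp [h]
  rw [Config.step, dif_neg h', this]

theorem Config.step_of_halted {P : Program} {w : Word.{u}} {c : Config.{u} P} (h : c.Halted) :
    c.step w = c := dif_pos h

/-! ### A machine that decides in time `α · 4` -/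

namespace Machine

/-- An action of a machine with one flag cell (cell `0` of tape `0`, where the head of that tape
stays) and one work tape (tape `1`). -/
def action (s : Fin 7) (moveInput : Move) (flag cell : Bool) (move : Move) : Action 6 1 :=
  ⟨s, moveInput, ![flag, cell], ![.stay, move]⟩

/-- The transition function. Words are read as a sequence of commands `(u, v)`: write `u` and move
right or left according to `v`. A first bit is read in state `0` and only moves the head; from then
on state `1` reads `u` and state `2` reads `v`. On a blank the machine rejects. The flag is set
whenever state `1` is entered by a step and is cleared in between, so state `1` with cleared flag
occurs at time `ω` only.

From then on the machine moves right along the work tape: in state `5` it reads a cell and enters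
state `3` or `4` on reading `0` or `1`. Again the flag is set in states `3` and `4` and is cleared
in state `5`, so that it is clear in state `3` or `4` only at time `ω · 2`, when the limit state is
`3` if and only if infinitely many zeros have been read. -/
def next : Fin 6 → Option Bool → (Fin 2 → Bool) → Action 6 1
  | 0, none, r => action 6 .stay false (r 1) .stay
  | 0, some v, r => action 1 .right true (r 1) (if v then .right else .left)
  | 1, o, r => if r 0 then
        match o with
        | none => action 6 .stay false (r 1) .stay
        | some u => action 2 .right false u .stay
      else action 5 .stay false (r 1) .stay
  | 2, none, r => action 6 .stay false (r 1) .stay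
  | 2, some v, r => action 1 .right true (r 1) (if v then .right else .left)
  | 3, _, r => if r 0 then action 5 .stay false (r 1) .stay else action 6 .stay true (r 1) .stay
  | 4, _, r => if r 0 then action 5 .stay false (r 1) .stay else action 6 .stay false (r 1) .stay
  | 5, _, r => action (if r 1 then 4 else 3) .stay true (r 1) .right

/-- The machine: working states `0, …, 5`, halting state `6`, and two scratch tapes. -/
abbrev program : Program := ⟨6, 1, next⟩

/-- The configuration `c` has state `s`, input head at `hi`, flag `flag`, work head at `h`, and
work tape `y`. -/
structure At (c : Config.{u} program) (s : Fin 7) (hi : Ordinal.{u}) (flag : Bool)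
    (h : Ordinal.{u}) (y : Ordinal.{u} → Bool) : Prop where
  state : c.state = s
  headInput : c.headInput = hi
  head_zero : c.head 0 = 0
  flag : c.tape 0 0 = flag
  head : c.head 1 = h
  cells : c.tape 1 = y

variable {w : Word.{u}} {c : Config.{u} program} {hi h : Ordinal.{u}} {b u : Bool}
  {y : Ordinal.{u} → Bool}

theorem At.step {s : Fin 6} (hc : At c s.castSucc hi b h y) {s' : Fin 7} {m m' : Move}
    {b' u : Bool} (hn : ∀ r : Fin 2 → Bool, r 0 = b → r 1 = y h →
      next s (w.read hi) r = action s' m b' u m') :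
    At (c.step w) s' (m.apply hi) b' (m'.apply h) (Function.update y h u) := by
  obtain ⟨h1, h2, h3, h4, h5, h6⟩ := hc
  have := hn (fun i => c.tape i (c.head i)) ((congrArg _ h3).trans h4)
    ((congrArg _ h5).trans (congrFun h6 h))
  have e : program.next s (w.read c.headInput) (fun i => c.tape i (c.head i)) =
    action s' m b' u m' := by rw [h2]; exact this
  rw [Config.step_of_state (P := program) h1, e]
  subst h2 h4 h5 h6
  exact ⟨rfl, rfl, h3, by simp [action, h3], rfl, rfl⟩

theorem At.step_keep {s : Fin 6} (hc : At c s.castSucc hi b h y) {s' : Fin 7} {m m' : Move}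
    {b' : Bool} (hn : ∀ r : Fin 2 → Bool, r 0 = b → r 1 = y h →
      next s (w.read hi) r = action s' m b' (r 1) m') :
    At (c.step w) s' (m.apply hi) b' (m'.apply h) y := by
  have := hc.step (w := w) (u := y h) fun r h0 h1 => by rw [hn r h0 h1, h1]
  rwa [Function.update_eq_self] at this

theorem At.write (hc : At c 1 hi true h y) (hu : w.read hi = some u) :
    At (c.step w) 2 (hi + 1) false h (Function.update y h u) :=
  hc.step (s := 1) (m := .right) (m' := .stay) fun r h0 _ => by simp [next, hu, h0]

/-- The movement of the work head that is commanded by a bit of the input. -/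
def moveOf (v : Bool) : Move := if v then .right else .left

theorem At.move {s : Fin 7} (hs : s = 0 ∨ s = 2) (hc : At c s hi b h y)
    (hu : w.read hi = some u) :
    At (c.step w) 1 (hi + 1) true ((moveOf u).apply h) y := by
  obtain rfl | rfl := hs
  · exact hc.step_keep (s := 0) (m := .right) fun r h0 _ => by simp [next, hu, moveOf]
  · exact hc.step_keep (s := 2) (m := .right) fun r h0 _ => by simp [next, hu, moveOf]

theorem At.blank {s : Fin 7} (hs : s = 0 ∨ s = 1 ∧ b = true ∨ s = 2) (hc : At c s hi b h y)
    (hu : w.read hi = none) : (c.step w).Halted := by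
  obtain rfl | ⟨rfl, rfl⟩ | rfl := hs
  · exact (hc.step_keep (s := 0) (m := .stay) (m' := .stay)
      fun r h0 _ => by rw [hu]; rfl).state
  · exact (hc.step_keep (s := 1) (w := w) (m := .stay) (m' := .stay) (s' := 6) (b' := false)
      fun r h0 _ => by simp [next, h0, hu]).state
  · exact (hc.step_keep (s := 2) (m := .stay) (m' := .stay)
      fun r h0 _ => by rw [hu]; rfl).state

theorem At.leave (hc : At c 1 hi false h y) : At (c.step w) 5 hi false h y :=
  hc.step_keep (s := 1) (m := .stay) (m' := .stay) fun r h0 _ => by simp [next, h0]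

theorem At.scan (hc : At c 5 hi b h y) :
    At (c.step w) (if y h then 4 else 3) hi true (h + 1) y :=
  hc.step_keep (s := 5) (m := .stay) (m' := .right) fun r _ h1 => by simp [next, h1]

theorem At.advance {s : Fin 7} (hs : s = 3 ∨ s = 4) (hc : At c s hi true h y) :
    At (c.step w) 5 hi false h y := by
  obtain rfl | rfl := hs
  · exact hc.step_keep (s := 3) (m := .stay) (m' := .stay) fun r h0 _ => by simp [next, h0]
  · exact hc.step_keep (s := 4) (m := .stay) (m' := .stay) fun r h0 _ => by simp [next, h0]

theorem At.accept (hc : At c 3 hi false h y) : At (c.step w) 6 hi true h y :=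
  hc.step_keep (s := 3) (m := .stay) (m' := .stay) fun r h0 _ => by simp [next, h0]

theorem At.reject (hc : At c 4 hi false h y) : At (c.step w) 6 hi false h y :=
  hc.step_keep (s := 4) (m := .stay) (m' := .stay) fun r h0 _ => by simp [next, h0]

/-- The position of the work head before the `k`-th command. -/
noncomputable def workHead (w : Word.{u}) (k : ℕ) : Ordinal.{u} :=
  (program.run w (2 * k + 1 : ℕ)).head 1

/-- The content of the work tape before the `k`-th command. -/
noncomputable def workTape (w : Word.{u}) (k : ℕ) : Ordinal.{u} → Bool :=
  (program.run w (2 * k + 1 : ℕ)).tape 1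

theorem At.self {s : Fin 7} (hc : At c s hi b h y) : At c s hi b (c.head 1) (c.tape 1) :=
  ⟨hc.1, hc.2, hc.3, hc.4, rfl, rfl⟩

theorem at_zero (w : Word.{u}) : At (program.run w 0) 0 0 false 0 (fun _ => false) := by
  rw [Program.run_zero]
  exact ⟨rfl, rfl, rfl, rfl, rfl, rfl⟩

theorem run_one {w : Word.{u}} {v : Bool} (hv : w.read 0 = some v) :
    At (program.run w (1 : ℕ)) 1 1 true ((moveOf v).apply 0) (fun _ => false) := by
  have := (at_zero w).move (.inl rfl) hv
  rw [Program.run_natCast_succ]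
  simpa using this

theorem run_write {k : ℕ} (hk : ∀ n < 2 * k + 1, w.read n ≠ none) :
    At (program.run w (2 * k + 1 : ℕ)) 1 (2 * k + 1 : ℕ) true (workHead w k) (workTape w k) := by
  induction k with
  | zero =>
    obtain ⟨v, hv⟩ := Option.ne_none_iff_exists'.1 (hk 0 (by simp))
    simpa [workHead, workTape] using (run_one (by simpa using hv)).self
  | succ k ih =>
    obtain ⟨u, hu⟩ := Option.ne_none_iff_exists'.1 (hk (2 * k + 1) (by omega))
    obtain ⟨v, hv⟩ := Option.ne_none_iff_exists'.1 (hk (2 * k + 2) (by omega))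
    have h1 := (ih fun n hn => hk n (by omega)).write hu
    rw [← Program.run_natCast_succ, ← Nat.cast_succ] at h1
    have h2 := h1.move (.inr rfl) hv
    rw [← Program.run_natCast_succ, ← Nat.cast_succ] at h2
    exact h2.self

theorem run_move {k : ℕ} (hk : ∀ n < 2 * k + 1, w.read n ≠ none)
    (hu : w.read (2 * k + 1 : ℕ) = some u) :
    At (program.run w (2 * k + 2 : ℕ)) 2 (2 * k + 2 : ℕ) false (workHead w k)
      (Function.update (workTape w k) (workHead w k) u) := by
  have h1 := (run_write hk).write hu
  rwa [← Program.run_natCast_succ, ← Nat.cast_succ] at h1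

theorem run_write_succ {k : ℕ} {v : Bool} (hk : ∀ n < 2 * k + 1, w.read n ≠ none)
    (hu : w.read (2 * k + 1 : ℕ) = some u) (hv : w.read (2 * k + 2 : ℕ) = some v) :
    workHead w (k + 1) = (moveOf v).apply (workHead w k) ∧
      workTape w (k + 1) = Function.update (workTape w k) (workHead w k) u := by
  have h1 := (run_move hk hu).move (.inr rfl) hv
  rw [← Program.run_natCast_succ] at h1
  exact ⟨h1.head, h1.cells⟩

theorem halted_of_finite {n : ℕ} (hn : ∀ m < n, w.read m ≠ none) (h : w.read n = none) :
    (program.run w (n + 1 : ℕ)).Halted := by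
  rw [Program.run_natCast_succ]
  obtain ⟨k, rfl | rfl⟩ : ∃ k, n = 2 * k ∨ n = 2 * k + 1 := ⟨n / 2, by omega⟩
  · cases k with
    | zero =>
      simp only [mul_zero, Nat.cast_zero] at h ⊢
      exact (at_zero w).blank (.inl rfl) h
    | succ k =>
      obtain ⟨u, hu⟩ := Option.ne_none_iff_exists'.1 (hn (2 * k + 1) (by omega))
      exact (run_move (fun m hm => hn m (by omega)) hu).blank (.inr (.inr rfl)) h
  · exact (run_write hn).blank (.inr (.inl ⟨rfl, rfl⟩)) h

theorem frequently_two_mul {p : ℕ → Prop} {q : ℕ → Prop} (d : ℕ) (hq : ∃ᶠ k in atTop, q k)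
    (h : ∀ k, q k → p (2 * k + d)) : ∃ᶠ n in atTop, p n := by
  rw [frequently_atTop] at hq ⊢
  intro N
  obtain ⟨k, hk, hqk⟩ := hq N
  exact ⟨2 * k + d, by omega, h k hqk⟩

section Infinite

variable (hw : ∀ n : ℕ, w.read n ≠ none)
include hw

theorem run_ne_zero {n : ℕ} (hn : n ≠ 0) : 1 ≤ (program.run w n).state ∧
    (program.run w n).head 0 = 0 := by
  obtain ⟨k, rfl | rfl⟩ : ∃ k, n = 2 * k + 2 ∨ n = 2 * k + 1 := ⟨(n - 1) / 2, by omega⟩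
  · obtain ⟨u, hu⟩ := Option.ne_none_iff_exists'.1 (hw (2 * k + 1))
    have := run_move (fun n _ => hw n) hu
    rw [this.state]
    exact ⟨by decide, this.head_zero⟩
  · have := run_write (k := k) fun n _ => hw n
    rw [this.state]
    exact ⟨by decide, this.head_zero⟩

theorem run_omega0 : At (program.run w ω) 1 (program.run w ω).headInput false
    ((program.run w ω).head 1) ((program.run w ω).tape 1) := by
  have hs : (program.run w ω).state = 1 := by
    rw [← zero_add ω]
    refine state_add_omega0 ?_ ?_
    · filter_upwards [eventually_ne_atTop 0] with n hn
      simpa using (run_ne_zero hw hn).1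
    · refine frequently_two_mul 1 (Frequently.of_forall fun _ => trivial) fun k _ => ?_
      rw [zero_add]
      exact (run_write fun n _ => hw n).state
  refine ⟨hs, rfl, ?_, ?_, rfl, rfl⟩
  · have := pos_add_omega0_eq (P := program) (w := w) (β := 0) (i := some 0) (a := 0)
      (by simp) (by
        simp_rw [zero_add, hs]
        refine frequently_two_mul 1 (Frequently.of_forall fun _ => trivial) fun k _ => ?_
        have := run_write (w := w) (k := k) fun n _ => hw n
        exact ⟨this.state, this.head_zero⟩)
    rwa [zero_add] at this
  · rw [← zero_add ω]
    refine tape_add_omega0_eq_false_iff.2 ?_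
    refine frequently_two_mul 2 (Frequently.of_forall fun _ => trivial) fun k _ => ?_
    obtain ⟨u, hu⟩ := Option.ne_none_iff_exists'.1 (hw (2 * k + 1))
    rw [zero_add]
    exact (run_move (fun n _ => hw n) hu).flag

theorem run_scan (k : ℕ) : At (program.run w (ω + 1 + (2 * k : ℕ))) 5
    (program.run w ω).headInput false ((program.run w ω).head 1 + k)
    ((program.run w ω).tape 1) := by
  induction k with
  | zero =>
    have := (run_omega0 hw).leave (w := w)
    rw [← Program.run_succ] at this
    simpa using this
  | succ k ih =>
    have h1 := ih.scan (w := w)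
    rw [← Program.run_add_succ] at h1
    have h2 := h1.advance (w := w) (by split_ifs <;> simp)
    rw [← Program.run_add_succ] at h2
    rw [Nat.cast_succ, ← add_assoc]
    exact h2

theorem run_advance (k : ℕ) : At (program.run w (ω + 1 + (2 * k + 1 : ℕ)))
    (if (program.run w ω).tape 1 ((program.run w ω).head 1 + k) then 4 else 3)
    (program.run w ω).headInput true ((program.run w ω).head 1 + k + 1)
    ((program.run w ω).tape 1) := by
  have h1 := (run_scan hw k).scan (w := w)
  rwa [← Program.run_add_succ] at h1

open Classical in
theorem run_omega0_mul_two : ∃ hi h y, At (program.run w (ω * 2))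
    (if ∃ᶠ k : ℕ in atTop, (program.run w ω).tape 1 ((program.run w ω).head 1 + k) = false
      then 3 else 4) hi false h y := by
  have he : (ω * 2 : Ordinal.{u}) = ω + 1 + ω := by
    rw [← one_add_one_eq_two, mul_add, mul_one, add_assoc, one_add_omega0]
  rw [he]
  have hpar (p : ℕ → Prop) (h : ∀ᶠ k in atTop, p (2 * k) ∧ p (2 * k + 1)) :
      ∀ᶠ n in atTop, p n := by
    rw [eventually_atTop] at h ⊢
    obtain ⟨N, hN⟩ := h
    refine ⟨2 * N, fun n hn => ?_⟩
    obtain ⟨k, rfl | rfl⟩ : ∃ k, n = 2 * k ∨ n = 2 * k + 1 := ⟨n / 2, by omega⟩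
    exacts [(hN k (by omega)).1, (hN k (by omega)).2]
  have hs : (program.run w (ω + 1 + ω)).state =
      if ∃ᶠ k : ℕ in atTop, (program.run w ω).tape 1 ((program.run w ω).head 1 + k) = false
        then 3 else 4 := by
    split_ifs with hf
    · refine state_add_omega0 (hpar _ (Eventually.of_forall fun k => ?_)) ?_
      · rw [(run_scan hw k).state, (run_advance hw k).state]
        split_ifs <;> decide
      · refine frequently_two_mul 1 hf fun k hk => ?_
        rw [(run_advance hw k).state, hk]
        rfl
    · have hf' := not_frequently.1 hf
      have hst (k : ℕ)
          (hk : ¬ (program.run w ω).tape 1 ((program.run w ω).head 1 + k) = false) :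
          (program.run w (ω + 1 + (2 * k + 1 : ℕ))).state = 4 := by
        rw [(run_advance hw k).state, if_pos (by simpa using hk)]
      refine state_add_omega0 (hpar _ (hf'.mono fun k hk => ?_)) ?_
      · rw [(run_scan hw k).state, hst k hk]
        exact ⟨by decide, by decide⟩
      · exact frequently_two_mul 1 hf'.frequently hst
  refine ⟨_, _, _, hs, rfl, ?_, ?_, rfl, rfl⟩
  · refine pos_add_omega0_eq (P := program) (i := some 0) (a := 0) (by simp) ?_
    refine (state_add_omega0_spec program w (ω + 1)).2.mono fun n hn => ⟨hn, ?_⟩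
    obtain ⟨k, rfl | rfl⟩ : ∃ k, n = 2 * k ∨ n = 2 * k + 1 := ⟨n / 2, by omega⟩
    exacts [(run_scan hw k).head_zero, (run_advance hw k).head_zero]
  · refine tape_add_omega0_eq_false_iff.2 ?_
    refine frequently_two_mul 0 (Frequently.of_forall fun _ => trivial) fun k _ => ?_
    exact (run_scan hw k).flag

/-- Every word with at least `ω` symbols is decided in `ω · 2 + 1` steps.
It is accepted if and only if, at time `ω`, the work tape contains
infinitely many zeros among the first `ω` cells from the position of the head on. -/
theorem halts_infinite : (program.run w (ω * 2 + 1)).Halted ∧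
    ((program.run w (ω * 2 + 1)).output = true ↔
      ∃ᶠ k : ℕ in atTop, (program.run w ω).tape 1 ((program.run w ω).head 1 + k) = false) := by
  obtain ⟨hi, h, y, hc⟩ := run_omega0_mul_two hw
  rw [Program.run_succ]
  split_ifs at hc with hf
  · exact ⟨hc.accept.state, iff_of_true hc.accept.flag hf⟩
  · exact ⟨hc.reject.state, iff_of_false (by rw [Config.output, hc.reject.flag]; simp) hf⟩

end Infinite

/-- The words that the machine accepts. -/
def language : Set Word.{u} :=
  {w | ∃ t, program.HaltsAt w t ∧ (program.run w t).output = true}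

end Machine

theorem Program.HaltsAt.unique {P : Program} {w : Word.{u}} {s t : Ordinal.{u}}
    (hs : P.HaltsAt w s) (ht : P.HaltsAt w t) : s = t :=
  le_antisymm (le_of_not_gt fun h => hs.2 _ h ht.1) (le_of_not_gt fun h => ht.2 _ h hs.1)

theorem Program.exists_haltsAt {P : Program} {w : Word.{u}} {t : Ordinal.{u}}
    (h : (P.run w t).Halted) : ∃ s ≤ t, P.HaltsAt w s := by
  obtain ⟨s, hs, hmin⟩ := WellFounded.has_min (wellFounded_lt (α := Ordinal.{u}))
    {s | (P.run w s).Halted} ⟨t, h⟩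
  exact ⟨s, le_of_not_gt (hmin t h), hs, fun r hr hr' => hmin r hr' hr⟩

theorem Word.read_eq_none_iff {w : Word.{u}} {ξ : Ordinal.{u}} :
    w.read ξ = none ↔ w.length ≤ ξ := by
  simp [Word.read, Word.length]

namespace Machine

theorem exists_halted (w : Word.{u}) : ∃ t, (program.run w t).Halted ∧
    (w.length ≠ 0 → t ≤ w.length * 4) := by
  classical
  by_cases h : ∃ n : ℕ, w.read n = none
  · refine ⟨_, halted_of_finite (n := Nat.find h) (fun m hm => Nat.find_min h hm)
      (Nat.find_spec h), fun h0 => ?_⟩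
    have hl : w.length = Nat.find h := by
      obtain ⟨n, hn⟩ := lt_omega0.1
        ((Word.read_eq_none_iff.1 (Nat.find_spec h)).trans_lt (natCast_lt_omega0 _))
      refine (Word.read_eq_none_iff.1 (Nat.find_spec h)).antisymm ?_
      rw [hn]
      exact_mod_cast Nat.find_min' h (Word.read_eq_none_iff.2 hn.le)
    rw [hl] at h0 ⊢
    have : Nat.find h ≠ 0 := by exact_mod_cast h0
    exact_mod_cast (by omega : Nat.find h + 1 ≤ Nat.find h * 4)
  · push Not at h
    refine ⟨_, (halts_infinite h).1, fun _ => ?_⟩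
    have hl : ω ≤ w.length := omega0_le.2 fun n =>
      le_of_not_ge fun hn => h n (Word.read_eq_none_iff.2 hn)
    calc (ω * 2 + 1 : Ordinal.{u}) ≤ ω * 2 + ω * 2 := by
          gcongr
          rw [← one_add_one_eq_two, mul_add, mul_one]
          exact one_lt_omega0.le.trans le_self_add
      _ = ω * 4 := by rw [← mul_add]; norm_num
      _ ≤ w.length * 4 := by gcongr

theorem decidesInTime : program.DecidesInTime language.{u} fun α => α * 4 := by
  intro w
  obtain ⟨t, ht, hle⟩ := exists_halted w
  obtain ⟨s, hst, hs⟩ := Program.exists_haltsAt ht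
  refine ⟨s, hs, ⟨fun h => ⟨s, hs, h⟩, ?_⟩, fun h0 => hst.trans (hle h0)⟩
  rintro ⟨t', ht', h⟩
  rwa [hs.unique ht']

end Machine

/-! ### A path that visits every cell infinitely often -/

/-- The path `0; 0, 1, 0; 0, 1, 2, 1, 0; …`, whose `s`-th excursion goes up to `s` and back and
starts at time `s ^ 2`. -/
def zigzag (k : ℕ) : ℕ := min (k - k.sqrt ^ 2) ((k.sqrt + 1) ^ 2 - 1 - k)

theorem zigzag_zero : zigzag 0 = 0 := by simp [zigzag]

theorem zigzag_sq_add {s i : ℕ} (h : i ≤ 2 * s) : zigzag (s ^ 2 + i) = min i (2 * s - i) := by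
  have : (s ^ 2 + i).sqrt = s := by
    refine (Nat.eq_sqrt'.2 ⟨?_, ?_⟩).symm <;> nlinarith
  rw [zigzag, this]
  congr 1
  · omega
  · ring_nf; omega

/-- Two consecutive zeros are no exception: truncated subtraction stays at `0`, as a head does. -/
theorem zigzag_succ (k : ℕ) : zigzag (k + 1) = zigzag k + 1 ∨ zigzag (k + 1) = zigzag k - 1 := by
  obtain ⟨s, i, hi, rfl⟩ : ∃ s i, i ≤ 2 * s ∧ k = s ^ 2 + i := by
    refine ⟨k.sqrt, k - k.sqrt ^ 2, ?_, ?_⟩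
    · have := k.sqrt_le_add; rw [pow_two]; omega
    · have := k.sqrt_le'; omega
  rcases hi.lt_or_eq with h | rfl
  · rw [zigzag_sq_add hi, add_assoc, zigzag_sq_add (by omega : i + 1 ≤ 2 * s)]
    omega
  · rw [zigzag_sq_add hi, show s ^ 2 + 2 * s + 1 = (s + 1) ^ 2 + 0 by ring,
      zigzag_sq_add (by omega)]
    omega

theorem frequently_zigzag_eq (c : ℕ) : ∃ᶠ k in atTop, zigzag k = c := by
  refine frequently_atTop.2 fun N => ⟨(N + c) ^ 2 + c, by nlinarith, ?_⟩
  rw [zigzag_sq_add (by omega)]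
  omega

/-! ### Self-referential sequences -/

/-- Recursion on the length of the prefix: a sequence may be defined by any rule that determines
the `n`-th bit from the earlier ones. -/
theorem exists_forall_eq_of_local (F : ℕ → (ℕ → Bool) → Bool)
    (hF : ∀ n x y, (∀ i < n, x i = y i) → F n x = F n y) : ∃ x : ℕ → Bool, ∀ n, x n = F n x := by
  let a : ℕ → ℕ → Bool := fun n =>
    Nat.rec (fun _ => false) (fun n b => Function.update b n (F n b)) n
  have ha (n : ℕ) : a (n + 1) = Function.update (a n) n (F n (a n)) := rfl
  have hst (i n : ℕ) (h : i < n) : a n i = a (i + 1) i := by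
    induction n, h using Nat.le_induction with
    | base => rfl
    | succ n hn ih => rw [ha, Function.update_of_ne (by omega), ih]
  refine ⟨fun n => a (n + 1) n, fun n => ?_⟩
  show a (n + 1) n = _
  rw [ha, Function.update_self]
  exact hF _ _ _ fun i hi => hst i n hi

open Classical in
/-- Let `R c m n` depend on the first `n` bits only. There is a sequence of commands, with moves
along `zigzag`, that writes a zero into cell `c` infinitely often if and only if
`∀ m, ∃ n, R c m n` holds of the sequence itself. On each visit to `c` after `m` zeros have been
written there, a zero is written if a witness `n` for `m` has shown up by then. -/
theorem exists_fixedPoint (R : ℕ → ℕ → ℕ → (ℕ → Bool) → Prop)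
    (hR : ∀ c m n x y, (∀ i < n, x i = y i) → (R c m n x ↔ R c m n y)) :
    ∃ x : ℕ → Bool, x 0 = false ∧
      (∀ k, x (2 * k + 2) = true ↔ zigzag (k + 1) = zigzag k + 1) ∧
      ∀ c, (∃ᶠ k in atTop, zigzag k = c ∧ x (2 * k + 1) = false) ↔ ∀ m, ∃ n, R c m n x := by
  -- The number of zeros written into cell `c` by the commands before the `k`-th one.
  let count (x : ℕ → Bool) (c k : ℕ) : ℕ :=
    Nat.count (fun k => zigzag k = c ∧ x (2 * k + 1) = false) k
  have hcount (x y : ℕ → Bool) (c k : ℕ) (h : ∀ i < 2 * k + 1, x i = y i) :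
      count x c k = count y c k := by
    simp only [count, Nat.count_eq_card_filter_range]
    congr 1
    refine Finset.filter_congr fun j hj => ?_
    rw [h _ (by have := Finset.mem_range.1 hj; omega)]
  obtain ⟨x, hx⟩ := exists_forall_eq_of_local
    (fun n x => if n % 2 = 1 then
        decide (¬ ∃ j ≤ n / 2, R (zigzag (n / 2)) (count x (zigzag (n / 2)) (n / 2)) j x)
      else decide (n ≠ 0 ∧ zigzag (n / 2) = zigzag (n / 2 - 1) + 1)) (by
    intro n x y h
    split_ifs with hn
    · congr 2
      have : n = 2 * (n / 2) + 1 := by omega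
      rw [hcount x y _ _ (by rwa [← this])]
      refine propext (exists_congr fun j => and_congr_right fun hj => ?_)
      exact hR _ _ _ _ _ fun i hi => h i (by omega)
    · rfl)
  have hodd (k : ℕ) : x (2 * k + 1) = false ↔
      ∃ j ≤ k, R (zigzag k) (count x (zigzag k) k) j x := by
    rw [hx, if_pos (by omega), show (2 * k + 1) / 2 = k by omega]
    simp
  refine ⟨x, by rw [hx]; simp, fun k => ?_, fun c => ⟨fun h m => ?_, fun h => ?_⟩⟩
  · rw [hx, if_neg (by omega), show (2 * k + 2) / 2 = k + 1 by omega]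
    simp
  · have hinf := Nat.frequently_atTop_iff_infinite.1 h
    obtain ⟨hc, h0⟩ := Nat.nth_mem_of_infinite hinf m
    obtain ⟨j, -, hj⟩ := (hodd _).1 h0
    rw [hc] at hj
    have : count x c (Nat.nth (fun k => zigzag k = c ∧ x (2 * k + 1) = false) m) = m :=
      Nat.count_nth_of_infinite hinf m
    rw [this] at hj
    exact ⟨j, hj⟩
  · by_contra hfin
    obtain ⟨N, hN⟩ := eventually_atTop.1 (not_frequently.1 hfin)
    have hconst (k : ℕ) (hk : N ≤ k) : count x c k = count x c N := by
      induction k, hk using Nat.le_induction with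
      | base => rfl
      | succ k hk ih =>
        simp only [count] at ih ⊢
        rw [Nat.count_succ, if_neg (hN k hk), ih, add_zero]
    obtain ⟨j, hj⟩ := h (count x c N)
    obtain ⟨k, hk, rfl⟩ := frequently_atTop.1 (frequently_zigzag_eq c) (max N j)
    refine hN k (by omega) ⟨rfl, (hodd k).2 ⟨j, by omega, ?_⟩⟩
    rwa [hconst k (by omega)]

/-! ### Words of length `ω` -/

/-- The word of length `ω` with the given symbols. -/
noncomputable def ofSeq (x : ℕ → Bool) : Word.{u} :=
  open Classical in ⟨ω, fun ξ => decide (∃ n : ℕ, ξ.1 = n ∧ x n = true)⟩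

theorem read_ofSeq (x : ℕ → Bool) (n : ℕ) : (ofSeq.{u} x).read n = some (x n) := by
  simp [ofSeq, Word.read]

theorem length_ofSeq (x : ℕ → Bool) : (ofSeq.{u} x).length = ω := rfl

theorem read_ofSeq_of_le (x : ℕ → Bool) {ξ : Ordinal.{u}} (h : ω ≤ ξ) :
    (ofSeq.{u} x).read ξ = none := by
  exact Word.read_eq_none_iff.2 h

namespace Machine

theorem moveOf_apply_natCast (v : Bool) (h : ℕ) :
    (moveOf v).apply (h : Ordinal.{u}) = ((if v then h + 1 else h - 1 : ℕ) : Ordinal.{u}) := by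
  cases v
  · cases h with
    | zero => simp [moveOf, Move.apply]
    | succ h => simp [moveOf, Move.apply]
  · simp [moveOf, Move.apply]

variable {x : ℕ → Bool}

/-- On a sequence of commands whose moves follow `zigzag`, the work head is on cell `0` at time
`ω`, and a cell contains a zero then if and only if zeros were written there infinitely often. -/
theorem halts_ofSeq (h0 : x 0 = false)
    (hdir : ∀ k, x (2 * k + 2) = true ↔ zigzag (k + 1) = zigzag k + 1) :
    (program.run (ofSeq.{u} x) (ω * 2 + 1)).Halted ∧
      ((program.run (ofSeq.{u} x) (ω * 2 + 1)).output = true ↔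
      ∃ᶠ c in atTop, ∃ᶠ k in atTop, zigzag k = c ∧ x (2 * k + 1) = false) := by
  have hread (n : ℕ) : (ofSeq.{u} x).read n ≠ none := by simp [read_ofSeq]
  have hnext (k : ℕ) := run_write_succ (w := ofSeq.{u} x) (k := k) (fun n _ => hread n)
    (read_ofSeq x _) (read_ofSeq x _)
  have hhead (k : ℕ) : workHead (ofSeq.{u} x) k = zigzag k := by
    induction k with
    | zero =>
      have := (run_one (w := ofSeq.{u} x) (by simpa using read_ofSeq x 0)).head
      rw [h0] at this
      simpa [zigzag_zero, moveOf, Move.apply, workHead] using this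
    | succ k ih =>
      rw [(hnext k).1, ih, moveOf_apply_natCast]
      congr 1
      split_ifs with h
      · exact ((hdir k).1 h).symm
      · exact ((zigzag_succ k).resolve_left (mt (hdir k).2 h)).symm
  have hW (k : ℕ) := run_write (w := ofSeq.{u} x) (k := k) fun n _ => hread n
  have hM (k : ℕ) := run_move (w := ofSeq.{u} x) (k := k) (fun n _ => hread n) (read_ofSeq x _)
  have hω := run_omega0 hread
  have hhω : (program.run (ofSeq.{u} x) ω).head 1 = 0 := by
    have := pos_add_omega0_eq (P := program) (w := ofSeq.{u} x) (β := 0) (i := some 1) (a := 0)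
      (by simp) (by
        simp_rw [zero_add, hω.state]
        refine frequently_two_mul 1 (frequently_zigzag_eq 0) fun k hk => ⟨(hW k).state, ?_⟩
        refine (hW k).head.trans ?_
        rw [hhead, hk, Nat.cast_zero])
    rwa [zero_add] at this
  have htape (c : ℕ) : (program.run (ofSeq.{u} x) ω).tape 1 c = false ↔
      ∃ᶠ k in atTop, zigzag k = c ∧ x (2 * k + 1) = false := by
    have := tape_add_omega0_eq_false_iff (P := program) (w := ofSeq.{u} x) (β := 0) (i := 1)
      (ξ := c)
    simp_rw [zero_add] at this
    rw [this]
    refine ⟨fun h => ?_, fun h => frequently_two_mul 2 h ?_⟩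
    · by_contra hfin
      obtain ⟨N, hN⟩ := eventually_atTop.1 (not_frequently.1 hfin)
      obtain ⟨K, hK, hKc⟩ := frequently_atTop.1 (frequently_zigzag_eq c) N
      have hstay (k : ℕ) (hk : K + 1 ≤ k) : workTape (ofSeq.{u} x) k c = true := by
        induction k, hk using Nat.le_induction with
        | base =>
          rw [(hnext K).2, hhead, hKc, Function.update_self]
          simpa [hKc] using hN K hK
        | succ k hk ih =>
          rw [(hnext k).2, hhead]
          by_cases hkc : zigzag k = c
          · rw [hkc, Function.update_self]
            simpa [hkc] using hN k (by omega)
          · rw [Function.update_of_ne (by exact_mod_cast Ne.symm hkc), ih]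
      refine h ?_
      filter_upwards [eventually_ge_atTop (2 * K + 3)] with n hn
      obtain ⟨k, rfl | rfl⟩ : ∃ k, n = 2 * k + 1 ∨ n = 2 * k + 2 := ⟨(n - 1) / 2, by omega⟩
      · rw [(hW k).cells, hstay k (by omega)]; simp
      · rw [(hM k).cells, ← (hnext k).2, hstay (k + 1) (by omega)]; simp
    · rintro k ⟨rfl, hk⟩
      rw [(hM k).cells, hhead, Function.update_self, hk]
  refine ⟨(halts_infinite hread).1, (halts_infinite hread).2.trans ?_⟩
  simp_rw [hhω, zero_add, htape]

end Machine

/-! ### Computations on words of length `ω` -/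

theorem Config.step_congr {P : Program} {w w' : Word.{u}} {c : Config.{u} P}
    (h : w.read c.headInput = w'.read c.headInput) : c.step w = c.step w' := by
  simp only [Config.step, h]

theorem Move.exists_apply_natCast (m : Move) (k : ℕ) :
    ∃ j : ℕ, j ≤ k + 1 ∧ m.apply (k : Ordinal.{u}) = j := by
  cases m
  · cases k with
    | zero => exact ⟨0, by simp [Move.apply]⟩
    | succ k => exact ⟨k, by omega, by simp [Move.apply]⟩
  · exact ⟨k, by simp [Move.apply]⟩
  · exact ⟨k + 1, by simp [Move.apply]⟩

theorem Config.pos_step {P : Program} (w : Word.{u}) (c : Config.{u} P)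
    (i : Option (Fin (P.tapes + 1))) : ∃ m : Move, (c.step w).pos i = m.apply (c.pos i) := by
  unfold Config.step
  split_ifs with h
  · exact ⟨.stay, rfl⟩
  · cases i <;> exact ⟨_, rfl⟩

theorem exists_pos_natCast (P : Program) (w : Word.{u}) (i : Option (Fin (P.tapes + 1))) (n : ℕ) :
    ∃ k : ℕ, k ≤ n ∧ (P.run w n).pos i = k := by
  induction n with
  | zero =>
    refine ⟨0, le_rfl, ?_⟩
    rw [Nat.cast_zero, P.run_zero]
    cases i <;> simp [Config.pos, Config.init]
  | succ n ih =>
    obtain ⟨k, hk, h⟩ := ih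
    rw [Program.run_natCast_succ]
    obtain ⟨m, hm⟩ := Config.pos_step w (P.run w n) i
    obtain ⟨j, hj, h'⟩ := m.exists_apply_natCast k
    exact ⟨j, by omega, by rw [hm, h, h']⟩

theorem tape_natCast_of_le (P : Program) (w : Word.{u}) (i : Fin (P.tapes + 1)) {ξ : Ordinal.{u}}
    (hξ : ω ≤ ξ) (n : ℕ) : (P.run w n).tape i ξ = false := by
  induction n with
  | zero => rw [Nat.cast_zero, P.run_zero]; rfl
  | succ n ih =>
    rw [Program.run_natCast_succ, Config.step]
    split_ifs with h
    · exact ih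
    · obtain ⟨k, -, hk⟩ := exists_pos_natCast P w (some i) n
      have : ξ ≠ (P.run w n).head i := fun e =>
        (hξ.trans_lt' (natCast_lt_omega0 k)).ne' (e.trans hk)
      exact (Function.update_of_ne this _ _).trans ih

theorem run_natCast_congr (P : Program) {x y : ℕ → Bool} {n : ℕ} (h : ∀ i < n, x i = y i) :
    P.run (ofSeq.{u} x) n = P.run (ofSeq y) n := by
  induction n with
  | zero => simp only [Nat.cast_zero, P.run_zero]
  | succ n ih =>
    rw [Program.run_natCast_succ, Program.run_natCast_succ, ← ih fun i hi => h i (by omega)]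
    obtain ⟨k, hk, hpos⟩ := exists_pos_natCast P (ofSeq.{u} x) none n
    refine Config.step_congr ?_
    rw [show (P.run (ofSeq.{u} x) n).headInput = k from hpos, read_ofSeq, read_ofSeq,
      h k (by omega)]

theorem tape_omega0_of_le (P : Program) (w : Word.{u}) (i : Fin (P.tapes + 1)) {ξ : Ordinal.{u}}
    (hξ : ω ≤ ξ) : (P.run w ω).tape i ξ = false := by
  have := tape_add_omega0_eq_false_iff (P := P) (w := w) (β := 0) (i := i) (ξ := ξ)
  simp_rw [zero_add] at this
  exact this.2 (Frequently.of_forall fun n => tape_natCast_of_le P w i hξ n)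

/-- At time `ω`, a head is either on the least cell on which it was infinitely often in the limit
state, or on cell `ω`. -/
theorem pos_omega0_cases (P : Program) (w : Word.{u}) (i : Option (Fin (P.tapes + 1))) :
    (∃ a : ℕ, (P.run w ω).pos i = a ∧
      (¬ ∃ᶠ n : ℕ in atTop, (P.run w n).state = (P.run w ω).state ∧
        ∃ b < a, (P.run w n).pos i = (b : ℕ)) ∧
      ∃ᶠ n : ℕ in atTop, (P.run w n).state = (P.run w ω).state ∧ (P.run w n).pos i = a) ∨
    (P.run w ω).pos i = ω := by
  classical
  have hev (a : ℕ) (h : ∀ b < a, ¬ ∃ᶠ n : ℕ in atTop,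
      (P.run w n).state = (P.run w ω).state ∧ (P.run w n).pos i = b) :
      ∀ᶠ n : ℕ in atTop, (P.run w n).state = (P.run w ω).state → ∀ b < a,
        (P.run w n).pos i ≠ (b : ℕ) := by
    have : ∀ᶠ n : ℕ in atTop, ∀ b ∈ Iio a,
        ¬ ((P.run w n).state = (P.run w ω).state ∧ (P.run w n).pos i = (b : ℕ)) :=
      (eventually_all_finite (finite_Iio a)).2 fun b hb => not_frequently.1 (h b hb)
    exact this.mono fun n hn hs b hb hp => hn b hb ⟨hs, hp⟩
  have hge {a n : ℕ} (h : ∀ b < a, (P.run w n).pos i ≠ (b : ℕ)) :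
      (a : Ordinal.{u}) ≤ (P.run w n).pos i := by
    obtain ⟨k, -, hk⟩ := exists_pos_natCast P w i n
    rw [hk]
    exact_mod_cast le_of_not_gt fun hka => h k hka hk
  by_cases h : ∃ a : ℕ, ∃ᶠ n : ℕ in atTop,
    (P.run w n).state = (P.run w ω).state ∧ (P.run w n).pos i = a
  · have hmin := hev (Nat.find h) fun b hb => Nat.find_min h hb
    refine .inl ⟨Nat.find h, ?_, ?_, Nat.find_spec h⟩
    · have := pos_add_omega0_eq (P := P) (w := w) (β := 0) (i := i) (a := Nat.find h)
      simp_rw [zero_add] at this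
      exact this (hmin.mono fun n hn hs => hge (hn hs)) (Nat.find_spec h)
    · exact not_frequently.2 (hmin.mono fun n hn ⟨hs, b, hb, hp⟩ => hn hs b hb hp)
  · refine .inr ?_
    push Not at h
    have hfr : ∃ᶠ n : ℕ in atTop,
        (P.run w (0 + n)).state = (P.run w (0 + ω)).state ∧ (P.run w (0 + n)).pos i ≤ 0 + ω := by
      refine (state_add_omega0_spec P w 0).2.mono fun n hn => ⟨hn, ?_⟩
      obtain ⟨k, -, hk⟩ := exists_pos_natCast P w i n
      rw [zero_add, zero_add, hk]
      exact (natCast_lt_omega0 k).le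
    rw [← zero_add ω, pos_add_omega0]
    refine (le_antisymm
      (liminfBelow_add_omega0_le (p := fun t => (P.run w t).state = (P.run w (0 + ω)).state)
        (f := fun t => (P.run w t).pos i) hfr)
      ((zero_add ω).trans_le (omega0_le.2 fun a => ?_))).trans rfl
    refine le_liminfBelow_add_omega0
      (p := fun t => (P.run w t).state = (P.run w (0 + ω)).state)
      (f := fun t => (P.run w t).pos i) ?_ hfr
    simp_rw [zero_add]
    exact (hev a fun b _ => not_frequently.2 ((h b).mono fun n hn hp => hn hp.1 hp.2)).mono
      fun n hn hs => hge (hn hs)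

/-! ### Snapshots -/

section Snapshot

variable (P : Program) (x y : ℕ → Bool) (K : ℕ)

/-- What can be seen of a configuration on the first `K` cells: the state, which of these cells
the heads are on, and the contents of these cells on the scratch tapes and on the input tape. -/
abbrev Snapshot : Type :=
  Fin (P.states + 1) × (Option (Fin (P.tapes + 1)) → Fin K → Prop) ×
    (Fin (P.tapes + 1) → Fin K → Bool) × (Fin K → Bool)

/-- The snapshot at time `t` of the computation on the word `x` of length `ω`. -/
noncomputable def snapshot (t : ℕ) : Snapshot P K :=
  let c := P.run (ofSeq.{u} x) t
  ⟨c.state, fun i j => c.pos i = (j : ℕ), fun i j => c.tape i (j : ℕ), fun j => x j⟩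

/-- The snapshots that occur infinitely often before time `ω`. -/
def recurrent : Set (Snapshot P K) :=
  {σ | ∃ᶠ t in atTop, snapshot.{u} P x K t = σ}

variable {P x y K}

/-- There are only finitely many snapshots, so the recurrent ones determine which properties of
snapshots hold infinitely often. -/
theorem frequently_snapshot (h : recurrent.{u} P x K = recurrent.{u} P y K)
    {φ : Snapshot P K → Prop} (hx : ∃ᶠ t in atTop, φ (snapshot.{u} P x K t)) :
    ∃ᶠ t in atTop, φ (snapshot.{u} P y K t) := by
  obtain ⟨t, ht, hφ⟩ :=
    ((eventually_frequently_eq (snapshot.{u} P x K)).and_frequently hx).exists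
  have : snapshot.{u} P x K t ∈ recurrent.{u} P y K := h ▸ ht
  exact Frequently.mono this fun s hs => hs ▸ hφ

theorem snapshot_congr {t n : ℕ} (hK : K ≤ n) (ht : t ≤ n) (h : ∀ i < n, x i = y i) :
    snapshot.{u} P x K t = snapshot.{u} P y K t := by
  simp only [snapshot]
  rw [run_natCast_congr.{u} P fun i hi => h i (hi.trans_le ht)]
  congr 3
  exact funext fun j => h _ (by omega)

theorem seq_eq_of_recurrent_eq (h : recurrent.{u} P x K = recurrent.{u} P y K) {j : ℕ}
    (hj : j < K) : x j = y j := by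
  obtain ⟨t, ht⟩ := (frequently_snapshot h (φ := fun σ => x j = σ.2.2.2 ⟨j, hj⟩)
    (Frequently.of_forall fun t => rfl)).exists
  exact ht

theorem state_eq_of_recurrent_eq (h : recurrent.{u} P x K = recurrent.{u} P y K) :
    (P.run (ofSeq.{u} x) ω).state = (P.run (ofSeq.{u} y) ω).state := by
  have key {x y : ℕ → Bool} (h : recurrent.{u} P x K = recurrent.{u} P y K) :
      (P.run (ofSeq.{u} y) ω).state ≤ (P.run (ofSeq.{u} x) ω).state := by
    have h1 := (state_add_omega0_spec P (ofSeq.{u} x) 0).2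
    have h2 := (state_add_omega0_spec P (ofSeq.{u} y) 0).1
    simp_rw [zero_add] at h1 h2
    have h3 := frequently_snapshot h (φ := fun σ => σ.1 = (P.run (ofSeq.{u} x) ω).state) h1
    obtain ⟨t, h4, h5⟩ := (h2.and_frequently h3).exists
    exact h4.trans_eq h5
  exact (key h.symm).antisymm (key h)

theorem tape_eq_of_recurrent_eq (h : recurrent.{u} P x K = recurrent.{u} P y K)
    (i : Fin (P.tapes + 1)) {j : ℕ} (hj : j < K) :
    (P.run (ofSeq.{u} x) ω).tape i j = (P.run (ofSeq.{u} y) ω).tape i j := by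
  have hiff (x : ℕ → Bool) := tape_add_omega0_eq_false_iff (P := P) (w := ofSeq.{u} x) (β := 0)
    (i := i) (ξ := j)
  simp_rw [zero_add] at hiff
  have key {x y : ℕ → Bool} (h : recurrent.{u} P x K = recurrent.{u} P y K)
      (hx : (P.run (ofSeq.{u} x) ω).tape i j = false) :
      (P.run (ofSeq.{u} y) ω).tape i j = false :=
    (hiff y).2 (frequently_snapshot h (φ := fun σ => σ.2.2.1 i ⟨j, hj⟩ = false) ((hiff x).1 hx))
  exact Bool.eq_iff_iff.2 (by simpa using (Iff.intro (key h) (key h.symm)).not)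

theorem pos_eq_of_recurrent_eq (h : recurrent.{u} P x K = recurrent.{u} P y K)
    {i : Option (Fin (P.tapes + 1))} {j : ℕ} (hj : j < K)
    (hx : (P.run (ofSeq.{u} x) ω).pos i = j) : (P.run (ofSeq.{u} y) ω).pos i = j := by
  rcases pos_omega0_cases P (ofSeq.{u} x) i with ⟨a, ha, h1, h2⟩ | hω
  · obtain rfl : a = j := by exact_mod_cast ha.symm.trans hx
    rw [state_eq_of_recurrent_eq h] at h1 h2
    have h2' := frequently_snapshot h
      (φ := fun σ => σ.1 = (P.run (ofSeq.{u} y) ω).state ∧ σ.2.1 i ⟨a, hj⟩) h2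
    have h1' : ¬ ∃ᶠ n : ℕ in atTop, (P.run (ofSeq.{u} y) n).state =
        (P.run (ofSeq.{u} y) ω).state ∧ ∃ b < a, (P.run (ofSeq.{u} y) n).pos i = (b : ℕ) := by
      refine fun hy => h1 ?_
      refine (frequently_snapshot h.symm (φ := fun σ => σ.1 = (P.run (ofSeq.{u} y) ω).state ∧
        ∃ b : Fin K, b < a ∧ σ.2.1 i b) (hy.mono ?_)).mono ?_
      · rintro n ⟨hs, b, hb, hp⟩
        exact ⟨hs, ⟨b, by omega⟩, hb, hp⟩
      · rintro n ⟨hs, b, hb, hp⟩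
        exact ⟨hs, b, hb, hp⟩
    have := pos_add_omega0_eq (P := P) (w := ofSeq.{u} y) (β := 0) (i := i) (a := a)
    simp_rw [zero_add] at this
    refine this ((not_frequently.1 h1').mono fun n hn hs => ?_) h2'
    obtain ⟨k, -, hk⟩ := exists_pos_natCast P (ofSeq.{u} y) i n
    rw [hk]
    exact_mod_cast le_of_not_gt fun hka => hn ⟨hs, k, hka, hk⟩
  · exact absurd (hω.symm.trans hx) (natCast_lt_omega0 j).ne'

end Snapshot

/-! ### Computations of at most `ω · 2` steps -/

theorem Config.output_eq_of_halted {P : Program} {w : Word.{u}} {β : Ordinal.{u}} {k l : ℕ}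
    (hk : (P.run w (β + k)).Halted) (hl : (P.run w (β + l)).Halted) :
    (P.run w (β + k)).output = (P.run w (β + l)).output := by
  have key {k : ℕ} (hk : (P.run w (β + k)).Halted) (l : ℕ) (h : k ≤ l) :
      P.run w (β + l) = P.run w (β + k) := by
    induction l, h using Nat.le_induction with
    | base => rfl
    | succ l _ ih => rw [Program.run_add_succ, ih, step_of_halted hk]
  rcases le_total k l with h | h
  · rw [key hk l h]
  · rw [key hl k h]

/-- At a limit time, a machine has not just stopped, so a computation of length at most `ω · 2`
ends after fewer than `ω · 2` steps. -/
theorem Program.HaltsAt.exists_omega0_add {P : Program} {w : Word.{u}} {t : Ordinal.{u}}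
    (h : P.HaltsAt w t) (ht : t ≤ ω * 2) :
    ∃ k : ℕ, (P.run w (ω + k)).Halted ∧ (P.run w (ω + k)).output = (P.run w t).output := by
  have h2 : (ω * 2 : Ordinal.{u}) = ω + ω := by rw [← one_add_one_eq_two, mul_add, mul_one]
  rcases lt_or_ge t ω with htω | hωt
  · obtain ⟨n, rfl⟩ := lt_omega0.1 htω
    have hconst (m : ℕ) (hm : n ≤ m) : P.run w m = P.run w n := by
      induction m, hm using Nat.le_induction with
      | base => rfl
      | succ m _ ih => rw [Program.run_natCast_succ, ih, Config.step_of_halted h.1]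
    have hev : ∀ᶠ m : ℕ in atTop, P.run w (0 + m) = P.run w n := by
      filter_upwards [eventually_ge_atTop n] with m hm
      rw [zero_add, hconst m hm]
    refine ⟨0, ?_, ?_⟩
    · rw [Nat.cast_zero, add_zero, ← zero_add ω]
      exact state_add_omega0 (hev.mono fun m hm => by rw [hm]; exact h.1.ge)
        (hev.frequently.mono fun m hm => by rw [hm]; exact h.1)
    · rw [Nat.cast_zero, add_zero, ← zero_add ω]
      cases ho : (P.run w n).output
      · exact tape_add_omega0_eq_false_iff.2 (hev.frequently.mono fun m hm => by rw [hm]; exact ho)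
      · exact tape_add_omega0_eq_true (hev.mono fun m hm => by rw [hm]; exact ho)
  · obtain ⟨d, rfl⟩ := exists_add_of_le hωt
    rw [h2, add_le_add_iff_left] at ht
    rcases ht.lt_or_eq with hd | rfl
    · obtain ⟨k, rfl⟩ := lt_omega0.1 hd
      exact ⟨k, h.1, rfl⟩
    · obtain ⟨k, hk⟩ := (state_add_omega0_spec P w ω).2.exists
      exact absurd (hk.trans h.1) (h.2 _ (by simp))

theorem Machine.haltsAt_omega0_mul_two_add_one {w : Word.{u}} (hw : ∀ n : ℕ, w.read n ≠ none) :
    Machine.program.HaltsAt w (ω * 2 + 1) := by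
  refine ⟨(halts_infinite hw).1, fun s hs h => ?_⟩
  obtain ⟨r, hr, hhalt⟩ := Program.exists_haltsAt h
  obtain ⟨k, hk, -⟩ := hhalt.exists_omega0_add (hr.trans (lt_add_one_iff.1 hs))
  have key {s : Fin 7} (hst : (program.run w (ω + k)).state = s) (h6 : s ≠ 6) : False :=
    h6 (hst.symm.trans hk)
  obtain rfl | ⟨j, rfl⟩ : k = 0 ∨ ∃ j, k = 1 + j := by
    rcases k with _ | j
    exacts [.inl rfl, .inr ⟨j, add_comm _ _⟩]
  · rw [Nat.cast_zero, add_zero] at key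
    exact key (run_omega0 hw).state (by decide)
  · rw [Nat.cast_add, Nat.cast_one, ← add_assoc] at key
    obtain ⟨i, rfl | rfl⟩ : ∃ i, j = 2 * i ∨ j = 2 * i + 1 := ⟨j / 2, by omega⟩
    · exact key (run_scan hw i).state (by decide)
    · exact key (run_advance hw i).state (by split_ifs <;> decide)

/-- The cells on which finite computations from time `ω` on are compared. -/
def window (K : ℕ) : Set Ordinal.{u} := {ξ | ξ < K ∨ ω ≤ ξ}

theorem eventually_mem_window (ξ : Ordinal.{u}) : ∀ᶠ K in atTop, ξ ∈ window K := by
  rcases lt_or_ge ξ ω with h | h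
  · obtain ⟨n, rfl⟩ := lt_omega0.1 h
    filter_upwards [eventually_gt_atTop n] with K hK
    exact .inl (by exact_mod_cast hK)
  · exact Eventually.of_forall fun K => .inr h

/-- Two configurations have the same state and head positions, and the same contents of the cells
in `S`. -/
structure Config.AgreeOn {P : Program} (S : Set Ordinal.{u}) (c d : Config.{u} P) : Prop where
  state : c.state = d.state
  pos : ∀ i, c.pos i = d.pos i
  tape : ∀ i, ∀ ξ ∈ S, c.tape i ξ = d.tape i ξ

theorem Config.AgreeOn.step {P : Program} {S : Set Ordinal.{u}} {c d : Config.{u} P}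
    {v w : Word.{u}} (h : c.AgreeOn S d) (hS : ∀ i, c.pos i ∈ S)
    (hr : ∀ ξ ∈ S, v.read ξ = w.read ξ) : (c.step v).AgreeOn S (d.step w) := by
  have hhead (i : Fin (P.tapes + 1)) : c.head i = d.head i := h.pos (some i)
  have hin : c.headInput = d.headInput := h.pos none
  by_cases hc : c.Halted
  · rwa [step_of_halted hc, step_of_halted (h.state.symm.trans hc)]
  · obtain ⟨s, hs⟩ : ∃ s : Fin P.states, c.state = s.castSucc :=
      ⟨c.state.castPred hc, (Fin.castSucc_castPred _ hc).symm⟩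
    have e1 : v.read c.headInput = w.read d.headInput := by
      rw [← hin]; exact hr _ (hS none)
    have e2 : (fun i => c.tape i (c.head i)) = fun i => d.tape i (d.head i) :=
      funext fun i => by rw [← hhead]; exact h.tape i _ (hS (some i))
    rw [step_of_state hs, step_of_state (h.state.symm.trans hs), e1, e2]
    refine ⟨rfl, ?_, fun i ξ hξ => ?_⟩
    · rintro (_ | i)
      · simp [Config.pos, hin]
      · simp [Config.pos, hhead]
    · simp only [hhead]
      by_cases e : ξ = d.head i
      · subst e; simp
      · rw [Function.update_of_ne e, Function.update_of_ne e, h.tape i ξ hξ]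

section Reject

variable (P : Program)

/-- On the word `x` of length `ω`, the program has stopped with output `b` at some time `ω + k`. -/
def Answers (x : ℕ → Bool) (b : Bool) : Prop :=
  ∃ k : ℕ, (P.run (ofSeq.{u} x) (ω + k)).Halted ∧ (P.run (ofSeq.{u} x) (ω + k)).output = b

/-- Some word with recurrent snapshots `D` is rejected, by a computation with no head between cells
`K` and `ω` at time `ω`. For large `K`, the recurrent snapshots of any word decide in this way
whether it is rejected. -/
def RejectsLike (K : ℕ) (D : Set (Snapshot P K)) : Prop :=
  ∃ x, recurrent.{u} P x K = D ∧ (∀ i, (P.run (ofSeq.{u} x) ω).pos i ∈ window K) ∧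
    Answers.{u} P x false

variable {P} {x : ℕ → Bool}

theorem eventually_rejectsLike (h : Answers.{u} P x false) :
    ∀ᶠ K in atTop, RejectsLike.{u} P K (recurrent.{u} P x K) :=
  (eventually_all.2 fun _ => eventually_mem_window _).mono fun _ hK => ⟨x, rfl, hK, h⟩

/-- The recurrent snapshots determine the configuration at time `ω` on the window, provided that
no head is outside of it. -/
theorem agreeOn_window {y : ℕ → Bool} {K : ℕ}
    (h : recurrent.{u} P x K = recurrent.{u} P y K)
    (hx : ∀ i, (P.run (ofSeq.{u} x) ω).pos i ∈ window K)
    (hy : ∀ i, (P.run (ofSeq.{u} y) ω).pos i ∈ window K) :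
    (P.run (ofSeq.{u} x) ω).AgreeOn (window K) (P.run (ofSeq.{u} y) ω) := by
  refine ⟨state_eq_of_recurrent_eq h, fun i => ?_, fun i ξ hξ => ?_⟩
  · have hcases (x : ℕ → Bool) (hx : (P.run (ofSeq.{u} x) ω).pos i ∈ window K) :
        (∃ j < K, (P.run (ofSeq.{u} x) ω).pos i = (j : ℕ)) ∨
          (P.run (ofSeq.{u} x) ω).pos i = ω := by
      refine (pos_omega0_cases P (ofSeq.{u} x) i).imp_left ?_
      rintro ⟨a, ha, -⟩
      rw [ha] at hx
      refine ⟨a, ?_, ha⟩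
      exact_mod_cast hx.resolve_right (natCast_lt_omega0 a).not_ge
    rcases hcases x (hx i) with ⟨j, hj, e⟩ | e
    · rw [e, pos_eq_of_recurrent_eq h hj e]
    · rcases hcases y (hy i) with ⟨j, hj, e'⟩ | e'
      · rw [e', pos_eq_of_recurrent_eq h.symm hj e']
      · rw [e, e']
  · rcases hξ with hξ | hξ
    · obtain ⟨j, rfl⟩ := lt_omega0.1 (hξ.trans (natCast_lt_omega0 K))
      exact tape_eq_of_recurrent_eq h i (by exact_mod_cast hξ)
    · rw [tape_omega0_of_le P _ i hξ, tape_omega0_of_le P _ i hξ]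

/-- An accepting computation of `k` steps from time `ω` on uses only a window, once `K` is large.
Another word with the same recurrent snapshots agrees with `x` there and is accepted, too. -/
theorem eventually_not_rejectsLike (h : Answers.{u} P x true) :
    ∀ᶠ K in atTop, ¬ RejectsLike.{u} P K (recurrent.{u} P x K) := by
  obtain ⟨k, hk, ho⟩ := h
  have hwin : ∀ᶠ K in atTop, ∀ j ∈ Iic k, ∀ i, (P.run (ofSeq.{u} x) (ω + j)).pos i ∈ window K :=
    (eventually_all_finite (finite_Iic k)).2 fun j _ =>
      eventually_all.2 fun _ => eventually_mem_window _
  filter_upwards [hwin, eventually_gt_atTop 0] with K hK hK0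
  rintro ⟨y, hy, hyw, l, hl, hlo⟩
  have hread : ∀ ξ ∈ window.{u} K, (ofSeq.{u} x).read ξ = (ofSeq.{u} y).read ξ := by
    rintro ξ (hξ | hξ)
    · obtain ⟨j, rfl⟩ := lt_omega0.1 (hξ.trans (natCast_lt_omega0 K))
      rw [read_ofSeq, read_ofSeq, seq_eq_of_recurrent_eq hy.symm (by exact_mod_cast hξ)]
    · rw [read_ofSeq_of_le _ hξ, read_ofSeq_of_le _ hξ]
  have hagree (j : ℕ) (hj : j ≤ k) : (P.run (ofSeq.{u} x) (ω + j)).AgreeOn (window K)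
      (P.run (ofSeq.{u} y) (ω + j)) := by
    induction j with
    | zero =>
      have := hK 0 k.zero_le
      simp only [Nat.cast_zero, add_zero] at this ⊢
      exact agreeOn_window hy.symm this hyw
    | succ j ih =>
      rw [Program.run_add_succ, Program.run_add_succ]
      exact (ih (by omega)).step (hK j (by simp; omega)) hread
  have hfin := hagree k le_rfl
  have hyk : (P.run (ofSeq.{u} y) (ω + k)).Halted := hfin.state.symm.trans hk
  have hyo : (P.run (ofSeq.{u} y) (ω + k)).output = true :=
    (hfin.tape 0 0 (.inl (by exact_mod_cast hK0))).symm.trans ho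
  rw [Config.output_eq_of_halted hyk hl, hlo] at hyo
  cases hyo

end Reject

/-! ### Diagonalization -/

section Diagonal

variable (P : Program)

/-- Triples `⟨K, D, N⟩`, which stand for the guess that `D` is the set of recurrent snapshots and
`N` is the least time from which on no others occur. For every `K` exactly one guess is right:
the component `N` serves to make it a `∀ m, ∃ n` statement. -/
abbrev Code : Type := Σ K : ℕ, Set (Snapshot P K) × ℕ

/-- Up to time `n`, the computation on `x` is consistent with the guess `q`, all of whose snapshots
occur between `m` and `n`, and the guess means rejection. -/
def Confirms (q : Code P) (m n : ℕ) (x : ℕ → Bool) : Prop :=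
  RejectsLike.{u} P q.1 q.2.1 ∧ m ≤ n ∧ q.1 ≤ n ∧ q.2.2 ≤ n ∧
    (∀ t, q.2.2 ≤ t → t ≤ n → snapshot.{u} P x q.1 t ∈ q.2.1) ∧
    (∀ t, q.2.2 = t + 1 → snapshot.{u} P x q.1 t ∉ q.2.1) ∧
    ∀ σ ∈ q.2.1, ∃ t, m ≤ t ∧ t ≤ n ∧ snapshot.{u} P x q.1 t = σ

variable {P} {x y : ℕ → Bool}

theorem Confirms.congr {q : Code P} {m n : ℕ} (h : ∀ i < n, x i = y i)
    (hx : Confirms.{u} P q m n x) : Confirms.{u} P q m n y := by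
  obtain ⟨h1, h2, h3, h4, h5, h6, h7⟩ := hx
  have hs (t : ℕ) (ht : t ≤ n) := snapshot_congr.{u} (P := P) h3 ht h
  refine ⟨h1, h2, h3, h4, fun t ht ht' => hs t ht' ▸ h5 t ht ht', fun t ht => ?_, fun σ hσ => ?_⟩
  · rw [← hs t (by omega)]
    exact h6 t ht
  · obtain ⟨t, ht, ht', e⟩ := h7 σ hσ
    exact ⟨t, ht, ht', (hs t ht').symm.trans e⟩

/-- The time from which on only recurrent snapshots occur. -/
noncomputable def settling (P : Program) (x : ℕ → Bool) (K : ℕ) : ℕ :=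
  sInf {N | ∀ t, N ≤ t → snapshot.{u} P x K t ∈ recurrent.{u} P x K}

theorem settling_spec (P : Program) (x : ℕ → Bool) (K : ℕ) {t : ℕ}
    (ht : settling.{u} P x K ≤ t) : snapshot.{u} P x K t ∈ recurrent.{u} P x K :=
  Nat.sInf_mem (eventually_atTop.1 (eventually_frequently_eq (snapshot.{u} P x K))) t ht

/-- A guess is confirmed over and over if and only if it is right and means rejection. -/
theorem forall_exists_confirms_iff {q : Code P} : (∀ m, ∃ n, Confirms.{u} P q m n x) ↔
    q = ⟨q.1, recurrent.{u} P x q.1, settling.{u} P x q.1⟩ ∧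
      RejectsLike.{u} P q.1 (recurrent.{u} P x q.1) := by
  obtain ⟨K, D, N⟩ := q
  constructor
  · intro h
    have hD : D = recurrent.{u} P x K := by
      ext σ
      refine ⟨fun hσ => frequently_atTop.2 fun m => ?_, fun hσ => ?_⟩
      · obtain ⟨n, hn⟩ := h m
        obtain ⟨t, ht, -, e⟩ := hn.2.2.2.2.2.2 σ hσ
        exact ⟨t, ht, e⟩
      · obtain ⟨t, ht, rfl⟩ := frequently_atTop.1 hσ N
        obtain ⟨n, hn⟩ := h t
        exact hn.2.2.2.2.1 t ht hn.2.1
    subst hD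
    obtain ⟨n, hn⟩ := h 0
    have hN : N = settling.{u} P x K := by
      refine le_antisymm (le_of_not_gt fun hlt => ?_) (Nat.sInf_le fun t ht => ?_)
      · exact hn.2.2.2.2.2.1 (N - 1) (by simp; omega) (settling_spec P x K (by omega))
      · obtain ⟨n, hn⟩ := h t
        exact hn.2.2.2.2.1 t ht hn.2.1
    subst hN
    exact ⟨rfl, hn.1⟩
  · rintro ⟨he, hr⟩ m
    obtain ⟨rfl, rfl⟩ : D = recurrent.{u} P x K ∧ N = settling.{u} P x K := by simpa using he
    have hfind : ∀ σ ∈ recurrent.{u} P x K, ∀ᶠ n in atTop,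
        ∃ t, m ≤ t ∧ t ≤ n ∧ snapshot.{u} P x K t = σ := fun σ hσ => by
      obtain ⟨t, ht, e⟩ := frequently_atTop.1 hσ m
      filter_upwards [eventually_ge_atTop t] with n hn using ⟨t, ht, hn, e⟩
    obtain ⟨n, hn, h1, h2, h3⟩ := (((eventually_all_finite (toFinite _)).2 hfind).and
      ((eventually_ge_atTop m).and ((eventually_ge_atTop K).and
        (eventually_ge_atTop (settling.{u} P x K))))).exists
    refine ⟨n, hr, h1, h2, h3, fun t ht _ => settling_spec P x K ht, fun t ht hmem => ?_, hn⟩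
    have : settling.{u} P x K ≤ t := Nat.sInf_le fun s hs => by
      rcases hs.lt_or_eq with h | rfl
      · exact settling_spec P x K (ht.trans_le h)
      · exact hmem
    simp only at ht
    omega

/-- The machine accepts the self-referential word of `exists_fixedPoint` if and only if infinitely
many guesses are confirmed over and over, that is, if and only if `P` rejects the word. -/
theorem not_decidesInTime_mul_two (P : Program) :
    ¬ P.DecidesInTime Machine.language.{u} fun α => α * 2 := by
  intro hP
  have hans (x : ℕ → Bool) : ∃ b, Answers.{u} P x b ∧
      (b = true ↔ ofSeq.{u} x ∈ Machine.language) := by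
    obtain ⟨t, ht, hL, hle⟩ := hP (ofSeq x)
    obtain ⟨k, hk, ho⟩ := ht.exists_omega0_add (hle (by simp [length_ofSeq]))
    exact ⟨_, ⟨k, hk, rfl⟩, by rw [ho, hL]⟩
  obtain ⟨e, he⟩ := exists_injective_nat (Code P)
  obtain ⟨x, h0, hdir, hx⟩ := exists_fixedPoint
    (fun c m n x => ∃ q, e q = c ∧ Confirms.{u} P q m n x)
    fun c m n x y h => exists_congr fun q => and_congr_right fun _ =>
      ⟨Confirms.congr h, Confirms.congr fun i hi => (h i hi).symm⟩
  have hx' (c : ℕ) : (∃ᶠ k in atTop, zigzag k = c ∧ x (2 * k + 1) = false) ↔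
      ∃ K, e ⟨K, recurrent.{u} P x K, settling.{u} P x K⟩ = c ∧
        RejectsLike.{u} P K (recurrent.{u} P x K) := by
    rw [hx c]
    constructor
    · intro h
      obtain ⟨-, q, rfl, -⟩ := h 0
      have hq : ∀ m, ∃ n, Confirms.{u} P q m n x := fun m => by
        obtain ⟨n, q', hq', hc⟩ := h m
        exact ⟨n, he hq' ▸ hc⟩
      obtain ⟨h1, h2⟩ := forall_exists_confirms_iff.1 hq
      exact ⟨q.1, congrArg e h1.symm, h2⟩
    · rintro ⟨K, rfl, hK⟩ m
      obtain ⟨n, hn⟩ := (forall_exists_confirms_iff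
        (q := ⟨K, recurrent.{u} P x K, settling.{u} P x K⟩)).2 ⟨rfl, hK⟩ m
      exact ⟨n, _, rfl, hn⟩
  obtain ⟨hhalt, hout⟩ := Machine.halts_ofSeq.{u} h0 hdir
  have hmem : ofSeq.{u} x ∈ Machine.language ↔ {c | ∃ K,
      e ⟨K, recurrent.{u} P x K, settling.{u} P x K⟩ = c ∧
        RejectsLike.{u} P K (recurrent.{u} P x K)}.Infinite := by
    rw [← Nat.frequently_atTop_iff_infinite]
    simp_rw [← hx']
    rw [← hout]
    have hM := Machine.haltsAt_omega0_mul_two_add_one (w := ofSeq.{u} x) (by simp [read_ofSeq])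
    refine ⟨?_, fun h => ⟨_, hM, h⟩⟩
    rintro ⟨t, ht, h⟩
    rwa [hM.unique ht]
  obtain ⟨b, hb, hbL⟩ := hans x
  -- Each `K` contributes at most one cell, and does so if and only if `RejectsLike` holds.
  cases b
  · obtain ⟨K₀, hK₀⟩ := eventually_atTop.1 (eventually_rejectsLike hb)
    refine absurd (hbL.2 (hmem.2 ?_)) (by simp)
    refine infinite_of_injective_forall_mem
      (f := fun j => e ⟨K₀ + j, recurrent.{u} P x _, settling.{u} P x _⟩) (fun i j hij => ?_)
      fun j => ⟨K₀ + j, rfl, hK₀ _ (by omega)⟩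
    have := congrArg Sigma.fst (he hij)
    simpa using this
  · obtain ⟨K₀, hK₀⟩ := eventually_atTop.1 (eventually_not_rejectsLike hb)
    refine hmem.1 (hbL.1 rfl) (((finite_Iio K₀).image
      fun K => e ⟨K, recurrent.{u} P x K, settling.{u} P x K⟩).subset ?_)
    rintro c ⟨K, rfl, hK⟩
    exact ⟨K, lt_of_not_ge fun h => hK₀ K h hK, rfl⟩

end Diagonal

end OTM

theorem mainTheorem3 :
    ∃ L : Set OTM.Word.{u},
      OTM.DecidableInTime L (fun α => α * 4) ∧ ¬ OTM.DecidableInTime L (fun α => α * 2) :=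
  ⟨OTM.Machine.language, ⟨_, OTM.Machine.decidesInTime⟩,
    fun ⟨P, hP⟩ => OTM.not_decidesInTime_mul_two P hP⟩
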